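/- All graphs are finite and simple. A tree-partition of a graph $G$ is a tree $T$ with sets $B_i\subseteq V(G)$ ($i\in V(T)$) such that each vertex of $G$ lies in exactly one $B_i$, and for each edge $uv$ of $G$ with $u\in B_i$, $v\in B_j$, either $i=j$ or $ij\in E(T)$. Its width is $\max_i|B_i|$, and the tree-partition-width $\mathrm{tpw}(G)$ is the minimum width of a tree-partition of $G$. A tree-cut decomposition of $G$ is a rooted tree $T$ with sets $X_t\subseteq V(G)$ ($t\in V(T)$), possibly empty, such that each vertex of $G$ lies in exactly one $X_t$. For $e\in E(T)$ let $\mathrm{cut}(e)$ be the set of edges of $G$ whose endpoints lie in bags of different components of $T-e$. The adhesion $\mathrm{adh}(t)$ of a node $t$ is $|\mathrm{cut}(e)|$ for the edge $e$ joining $t$ to its parent (and $0$ if $t$ is the root). The torso-size is $\mathrm{tor}(t)=|X_t|+b_t$, where $b_t$ is the number of edges $e$ of $T$ incident to $t$ with $|\mathrm{cut}(e)|\ge 3$. The width of the decomposition is $\max_t\max\{\mathrm{adh}(t),\mathrm{tor}(t)\}$, and the tree-cut width $\mathrm{tcw}(G)$ is the minimum width of a tree-cut decomposition of $G$. Then: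 1. $\mathrm{tpw}(K_{3,n-3})\le 3$ for every $n\ge 3$. 2. $\mathrm{tcw}(K_{3,n-3})=\Omega(n^{1/4})$; precisely, there is a constant $c>0$ such that $\mathrm{tcw}(K_{3,n-3})\ge c\,n^{1/4}$ for every $n\ge 3$. In particular, the tree-cut width of the graphs $K_{3,n-3}$ is unbounded. 3. Consequently, bounded tree-partition-width does not imply bounded tree-cut width: there is no function $f:\mathbb N\to\mathbb N$ such that $\mathrm{tcw}(G)\le f(\mathrm{tpw}(G))$ for every graph $G$. -/

import Mathlib

namespace SimpleGraph

/-- A tree-partition of `G`: a (finite) tree `T` together with bags indexed by its nodes, such that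
every vertex lies in exactly one bag and the endpoints of every edge of `G` lie in the same bag
or in bags of adjacent nodes. -/
structure TreePartition {V : Type*} (G : SimpleGraph V) where
  Node : Type
  [fintypeNode : Fintype Node]
  T : SimpleGraph Node
  isTree : T.IsTree
  bag : Node → Finset V
  existsUnique_mem_bag : ∀ v : V, ∃! i : Node, v ∈ bag i
  eq_or_adj : ∀ u v : V, G.Adj u v → ∀ i j : Node, u ∈ bag i → v ∈ bag j → i = j ∨ T.Adj i j

attribute [instance] TreePartition.fintypeNode

/-- The width of a tree-partition: the maximum size of a bag. -/
def TreePartition.width {V : Type*} {G : SimpleGraph V} (P : G.TreePartition) : ℕ :=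
  Finset.univ.sup fun i : P.Node => (P.bag i).card

/-- The tree-partition-width of a finite graph: the minimum width of a tree-partition.
(The one-node tree-partition always exists.) -/
noncomputable def treePartitionWidth {V : Type*} [Finite V] (G : SimpleGraph V) : ℕ :=
  sInf {k : ℕ | ∃ P : G.TreePartition, P.width = k}

/-- A tree-cut decomposition of `G`: a (finite) rooted tree `T` together with bags indexed by its
nodes which form a near partition of the vertex set: every vertex lies in exactly one bag, and
bags may be empty. -/
structure TreeCutDecomposition {V : Type*} (G : SimpleGraph V) where
  Node : Type
  [fintypeNode : Fintype Node]
  T : SimpleGraph Node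
  isTree : T.IsTree
  root : Node
  bag : Node → Finset V
  existsUnique_mem_bag : ∀ v : V, ∃! i : Node, v ∈ bag i

attribute [instance] TreeCutDecomposition.fintypeNode

namespace TreeCutDecomposition

variable {V : Type*} {G : SimpleGraph V}

/-- For an edge `e` of the tree, `D.cut e` is the set of edges of `G` whose two endpoints lie in
bags belonging to different components of `T - e`. -/
def cut (D : G.TreeCutDecomposition) (e : Sym2 D.Node) : Set (Sym2 V) :=
  {f | ∃ u v : V, f = s(u, v) ∧ G.Adj u v ∧ ∃ i j : D.Node, u ∈ D.bag i ∧ v ∈ D.bag j ∧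
    ¬ (D.T.deleteEdges {e}).Reachable i j}

/-- The parent of a node `t` other than the root: the second node on the unique path in `T`
from `t` to the root. (For the root itself the value is not used.) -/
noncomputable def parent (D : G.TreeCutDecomposition) (t : D.Node) : D.Node :=
  (D.isTree.existsUnique_path t D.root).choose.snd

open Classical in
/-- The adhesion of a node `t`: the size of the cut of the edge joining `t` to its parent.
The root has no such edge, and its adhesion is `0`. -/
noncomputable def adhesion (D : G.TreeCutDecomposition) (t : D.Node) : ℕ :=
  if t = D.root then 0 else (D.cut s(t, D.parent t)).ncard

/-- The torso-size of a node `t`: the size of its bag plus the number of tree edges incident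
to `t` whose cut has at least three elements. -/
noncomputable def torsoSize (D : G.TreeCutDecomposition) (t : D.Node) : ℕ :=
  (D.bag t).card + {e : Sym2 D.Node | e ∈ D.T.incidenceSet t ∧ 3 ≤ (D.cut e).ncard}.ncard

/-- The width of a tree-cut decomposition: the maximum of all adhesions and torso-sizes. -/
noncomputable def width (D : G.TreeCutDecomposition) : ℕ :=
  Finset.univ.sup fun t : D.Node => max (D.adhesion t) (D.torsoSize t)

end TreeCutDecomposition

/-- The tree-cut width of a finite graph: the minimum width of a tree-cut decomposition.
(The one-node decomposition always exists.) -/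
noncomputable def treeCutWidth {V : Type*} [Finite V] (G : SimpleGraph V) : ℕ :=
  sInf {k : ℕ | ∃ D : G.TreeCutDecomposition, D.width = k}

end SimpleGraph

namespace SimpleGraph

/-! For the upper bound, use a star whose centre bag is the side of size 3. For the lower bound, let
a decomposition of `K_{3,m}` have width `w < m`. A tree edge separating two vertices of the small
side cuts an edge at each of the `m` others, so the small side lies in one bag, at a node `t`. Each
remaining vertex is either in that bag or behind a tree edge at `t` whose cut contains its three
edges. Such tree edges count towards the torso-size, and each hides at most `w` vertices. Hence `m ≤
w + w²`, which is stronger than the fourth-root bound. -/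

/-- In a tree, two distinct nodes `i` and `j` are separated by an edge at `i`. -/
lemma IsTree.exists_adj_not_reachable_deleteEdges {N : Type*} {T : SimpleGraph N} (hT : T.IsTree)
    {i j : N} (hij : i ≠ j) :
    ∃ k, T.Adj i k ∧ ¬ (T.deleteEdges {s(i, k)}).Reachable i j := by
  obtain ⟨p, hp, -⟩ := hT.existsUnique_path i j
  cases p with
  | nil => exact absurd rfl hij
  | @cons _ k _ h q =>
    refine ⟨k, h, fun hr => ?_⟩
    have hbridge : T.IsBridge s(i, k) := isAcyclic_iff_forall_isBridge.1 hT.isAcyclic h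
    rw [Walk.cons_isPath_iff] at hp
    rw [isBridge_iff] at hbridge
    -- The rest of the path never returns to `i`, so it survives deletion of the edge and would link
    -- `i` to `k` around a bridge.
    exact hbridge (hr.trans
      (q.toDeleteEdge _ fun he => hp.2 (q.fst_mem_support_of_mem_edges he)).reachable.symm)

namespace TreeCutDecomposition

variable {V : Type*} {G : SimpleGraph V}

lemma parent_eq_of_isPath (D : G.TreeCutDecomposition) {t : D.Node} {p : D.T.Walk t D.root}
    (hp : p.IsPath) : D.parent t = p.snd := by
  rw [parent, (D.isTree.existsUnique_path t D.root).unique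
    (D.isTree.existsUnique_path t D.root).choose_spec.1 hp]

/-- Each edge of the tree joins one of its ends, which is not the root, to its parent. -/
lemma parent_eq_or_parent_eq_of_adj (D : G.TreeCutDecomposition) {i k : D.Node}
    (h : D.T.Adj i k) :
    (i ≠ D.root ∧ D.parent i = k) ∨ (k ≠ D.root ∧ D.parent k = i) := by
  obtain ⟨p, hp, -⟩ := D.isTree.existsUnique_path i D.root
  by_cases hk : k ∈ p.support
  · left
    have hsnd := D.isTree.isAcyclic.eq_snd_of_adj_start hp h hk
    refine ⟨?_, by rw [D.parent_eq_of_isPath hp, ← hsnd]⟩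
    rintro rfl
    have hnil := Walk.isPath_iff_nil.1 hp
    rw [Walk.nil_iff_support_eq] at hnil
    rw [hnil, List.mem_singleton] at hk
    exact h.ne hk.symm
  · right
    refine ⟨?_, (D.parent_eq_of_isPath (p := .cons h.symm p)
      ((Walk.cons_isPath_iff _ _).2 ⟨hp, hk⟩)).trans (Walk.snd_cons _ _)⟩
    rintro rfl
    exact hk p.end_mem_support

/-- Adhesion only sees edges from a node to its parent, but every tree edge is one of these. -/
lemma ncard_cut_le_width (D : G.TreeCutDecomposition) {i k : D.Node} (h : D.T.Adj i k) :
    (D.cut s(i, k)).ncard ≤ D.width := by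
  have key : ∀ t, D.adhesion t ≤ D.width := fun t =>
    (le_max_left _ _).trans
      (Finset.le_sup (f := fun t => max (D.adhesion t) (D.torsoSize t)) (Finset.mem_univ t))
  rcases D.parent_eq_or_parent_eq_of_adj h with ⟨hr, hp⟩ | ⟨hr, hp⟩
  · simpa [adhesion, hr, hp] using key i
  · simpa [adhesion, hr, hp, Sym2.eq_swap] using key k

lemma torsoSize_le_width (D : G.TreeCutDecomposition) (t : D.Node) : D.torsoSize t ≤ D.width :=
  (le_max_right _ _).trans
    (Finset.le_sup (f := fun t => max (D.adhesion t) (D.torsoSize t)) (Finset.mem_univ t))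

lemma mem_cut (D : G.TreeCutDecomposition) {e : Sym2 D.Node} {u v : V} (huv : G.Adj u v)
    {i j : D.Node} (hu : u ∈ D.bag i) (hv : v ∈ D.bag j)
    (h : ¬ (D.T.deleteEdges {e}).Reachable i j) : s(u, v) ∈ D.cut e :=
  ⟨u, v, rfl, huv, i, j, hu, hv, h⟩

end TreeCutDecomposition

section CompleteBipartite

variable {α β : Type*} [Finite α] [Finite β]

/-- If the width is less than `|β|`, then all of `α` lies in one bag. -/
lemma TreeCutDecomposition.eq_of_inl_mem_bag
    (D : (completeBipartiteGraph α β).TreeCutDecomposition) (hD : D.width < Nat.card β)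
    {a b : α} {i j : D.Node} (ha : Sum.inl a ∈ D.bag i) (hb : Sum.inl b ∈ D.bag j) : i = j := by
  by_contra hij
  obtain ⟨k, hik, hsep⟩ := D.isTree.exists_adj_not_reachable_deleteEdges hij
  -- Wherever `v` lies, the deleted tree edge separates it from `a` or from `b`.
  have hcross : ∀ v : β, ∃ x : α, s(Sum.inl x, Sum.inr v) ∈ D.cut s(i, k) := by
    intro v
    obtain ⟨l, hl, -⟩ := D.existsUnique_mem_bag (Sum.inr v)
    by_cases hil : (D.T.deleteEdges {s(i, k)}).Reachable i l
    · exact ⟨b, D.mem_cut (by simp) hb hl fun h => hsep (hil.trans h.symm)⟩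
    · exact ⟨a, D.mem_cut (by simp) ha hl hil⟩
  choose x hx using hcross
  have hinj : Function.Injective fun v : β =>
      (⟨s(Sum.inl (x v), Sum.inr v), hx v⟩ : D.cut s(i, k)) := by
    intro v w hvw
    simpa using (show _ ∧ _ by simpa using hvw).2
  have hcard := Nat.card_le_card_of_injective _ hinj
  rw [Nat.card_coe_set_eq] at hcard
  exact absurd (hcard.trans (D.ncard_cut_le_width hik)) hD.not_ge

lemma TreeCutDecomposition.card_right_le (D : (completeBipartiteGraph α β).TreeCutDecomposition)
    (hα : 3 ≤ Nat.card α) : Nat.card β ≤ D.width + D.width * D.width := by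
  classical
  have := Fintype.ofFinite β
  rcases le_or_gt (Nat.card β) D.width with hD | hD
  · exact hD.trans (Nat.le_add_right _ _)
  have hne : Nonempty α := (Nat.card_pos_iff.1 (by omega)).1
  obtain ⟨a₀⟩ := hne
  obtain ⟨t, ht, -⟩ := D.existsUnique_mem_bag (Sum.inl a₀)
  have hall : ∀ a : α, Sum.inl a ∈ D.bag t := by
    intro a
    obtain ⟨s, hs, -⟩ := D.existsUnique_mem_bag (Sum.inl a)
    rwa [D.eq_of_inl_mem_bag hD ht hs]
  have hout : ∀ v : β, Sum.inr v ∉ D.bag t → ∃ k, D.T.Adj t k ∧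
      ∀ a : α, s(Sum.inl a, Sum.inr v) ∈ D.cut s(t, k) := by
    intro v hv
    obtain ⟨l, hl, -⟩ := D.existsUnique_mem_bag (Sum.inr v)
    have htl : t ≠ l := by rintro rfl; exact hv hl
    obtain ⟨k, htk, hsep⟩ := D.isTree.exists_adj_not_reachable_deleteEdges htl
    exact ⟨k, htk, fun a => D.mem_cut (by simp) (hall a) hl hsep⟩
  have : Nonempty D.Node := ⟨t⟩
  choose! k hadj hcut using hout
  set heavy : Set (Sym2 D.Node) := {e | e ∈ D.T.incidenceSet t ∧ 3 ≤ (D.cut e).ncard} with hheavy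
  have htorso := D.torsoSize_le_width t
  rw [torsoSize, ← hheavy] at htorso
  let inside : Finset β := {v | Sum.inr v ∈ D.bag t}
  let outside : Finset β := {v | Sum.inr v ∉ D.bag t}
  have hin : inside.card ≤ (D.bag t).card :=
    Finset.card_le_card_of_injOn Sum.inr (fun v hv => by simpa [inside] using hv)
      Sum.inr_injective.injOn
  have hfin : heavy.Finite := Set.toFinite _
  -- Send each outside vertex to the tree edge at `t` leading to it. Its edges to `α` make that edge
  -- heavy, and its edge to `a₀` embeds the fibre in the cut.
  have hout : outside.card ≤ D.width * hfin.toFinset.card := by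
    refine Finset.card_le_mul_card_image_of_maps_to (f := fun v => s(t, k v)) ?_ _ ?_
    · intro v hv
      have hv : Sum.inr v ∉ D.bag t := by simpa [outside] using hv
      rw [Set.Finite.mem_toFinset]
      refine ⟨⟨hadj v hv, Sym2.mem_mk_left _ _⟩, hα.trans ?_⟩
      rw [← Nat.card_coe_set_eq]
      refine Nat.card_le_card_of_injective
        (fun a : α => (⟨s(Sum.inl a, Sum.inr v), hcut v hv a⟩ : D.cut s(t, k v))) ?_
      intro a b hab
      simpa using hab
    · intro e _
      rcases (outside.filter fun v => s(t, k v) = e).eq_empty_or_nonempty with he | ⟨v, hv⟩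
      · simp [he]
      obtain ⟨hvt, rfl⟩ : Sum.inr v ∉ D.bag t ∧ s(t, k v) = e := by simpa [outside] using hv
      refine le_trans ?_ (D.ncard_cut_le_width (hadj v hvt))
      rw [← Set.ncard_coe_finset]
      refine Set.ncard_le_ncard_of_injOn (fun w => s(Sum.inl a₀, Sum.inr w)) ?_ ?_
      · intro w hw
        have hw : Sum.inr w ∉ D.bag t ∧ s(t, k w) = s(t, k v) := by simpa [outside] using hw
        rw [← hw.2]
        exact hcut w hw.1 a₀
      · intro w _ w' _ h
        simpa using h
  have hsum : inside.card + outside.card = Nat.card β := by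
    rw [Nat.card_eq_fintype_card]
    exact Finset.card_filter_add_card_filter_not _
  rw [← Set.ncard_eq_toFinset_card] at hout
  rw [← hsum]
  refine add_le_add (by omega) (hout.trans (Nat.mul_le_mul_left _ (by omega)))

end CompleteBipartite

lemma TreeCutDecomposition.width_pos {V : Type*} [Nonempty V] {G : SimpleGraph V}
    (D : G.TreeCutDecomposition) : 0 < D.width := by
  obtain ⟨t, ht, -⟩ := D.existsUnique_mem_bag (Classical.arbitrary V)
  have hpos : 0 < (D.bag t).card := Finset.card_pos.2 ⟨_, ht⟩
  exact hpos.trans_le ((Nat.le_add_right _ _).trans (D.torsoSize_le_width t))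

lemma exists_treeCutDecomposition_width_eq {V : Type*} [Finite V] (G : SimpleGraph V) :
    ∃ D : G.TreeCutDecomposition, D.width = G.treeCutWidth := by
  have := Fintype.ofFinite V
  let D : G.TreeCutDecomposition :=
    { Node := Unit
      T := ⊥
      isTree := .of_subsingleton
      root := ()
      bag := fun _ => Finset.univ
      existsUnique_mem_bag := fun v => ⟨(), Finset.mem_univ v, fun _ _ => rfl⟩ }
  exact Nat.sInf_mem (s := {k | ∃ D : G.TreeCutDecomposition, D.width = k}) ⟨_, D, rfl⟩

lemma treeCutWidth_completeBipartiteGraph_three (m : ℕ) :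
    0 < (completeBipartiteGraph (Fin 3) (Fin m)).treeCutWidth ∧
    m ≤ (completeBipartiteGraph (Fin 3) (Fin m)).treeCutWidth +
      (completeBipartiteGraph (Fin 3) (Fin m)).treeCutWidth *
      (completeBipartiteGraph (Fin 3) (Fin m)).treeCutWidth := by
  obtain ⟨D, hD⟩ := exists_treeCutDecomposition_width_eq (completeBipartiteGraph (Fin 3) (Fin m))
  rw [← hD]
  exact ⟨D.width_pos, by simpa using D.card_right_le (by simp)⟩

/-- The star with centre bag `Fin 3` and singleton leaf bags. -/
def starTreePartition (m : ℕ) : (completeBipartiteGraph (Fin 3) (Fin m)).TreePartition where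
  Node := Option (Fin m)
  T := starGraph none
  isTree := isTree_starGraph none
  bag i := i.elim (Finset.univ.map .inl) fun v => {Sum.inr v}
  existsUnique_mem_bag := by
    rintro (a | v)
    · refine ⟨none, by simp, ?_⟩
      rintro (_ | w) h
      · rfl
      · simp at h
    · refine ⟨some v, by simp, ?_⟩
      rintro (_ | w) h
      · simp at h
      · simpa [eq_comm] using h
  eq_or_adj := by
    rintro (a | v) (b | w) h (_ | i) (_ | j) hi hj <;> simp_all

lemma treePartitionWidth_completeBipartiteGraph_three_le (m : ℕ) :
    (completeBipartiteGraph (Fin 3) (Fin m)).treePartitionWidth ≤ 3 := by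
  have hle : (completeBipartiteGraph (Fin 3) (Fin m)).treePartitionWidth ≤
      (starTreePartition m).width := Nat.sInf_le ⟨starTreePartition m, rfl⟩
  refine hle.trans (Finset.sup_le ?_)
  rintro (_ | v) -
  · exact (Finset.card_map _).le
  · exact (Finset.card_singleton _).le.trans (by norm_num)

lemma exists_lt_treeCutWidth_completeBipartiteGraph (B : ℕ) :
    ∃ n : ℕ, 3 ≤ n ∧ B < (completeBipartiteGraph (Fin 3) (Fin (n - 3))).treeCutWidth := by
  refine ⟨B + B * B + 1 + 3, by omega, ?_⟩
  have h := (treeCutWidth_completeBipartiteGraph_three (B + B * B + 1)).2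
  rw [Nat.add_sub_cancel]
  by_contra! hle
  have := Nat.mul_le_mul hle hle
  omega

end SimpleGraph

open SimpleGraph in
theorem mainTheorem7 :
    (∀ n : ℕ, 3 ≤ n →
      (completeBipartiteGraph (Fin 3) (Fin (n - 3))).treePartitionWidth ≤ 3) ∧
    (∃ c : ℝ, 0 < c ∧ ∀ n : ℕ, 3 ≤ n →
      c * (n : ℝ) ^ (1 / 4 : ℝ) ≤
        ((completeBipartiteGraph (Fin 3) (Fin (n - 3))).treeCutWidth : ℝ)) ∧
    (∀ B : ℕ, ∃ n : ℕ, 3 ≤ n ∧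
      B < (completeBipartiteGraph (Fin 3) (Fin (n - 3))).treeCutWidth) ∧
    (¬ ∃ f : ℕ → ℕ, ∀ (V : Type) [Finite V] (G : SimpleGraph V),
      G.treeCutWidth ≤ f G.treePartitionWidth) := by
  refine ⟨fun n _ => treePartitionWidth_completeBipartiteGraph_three_le _, ⟨1 / 5, by norm_num, ?_⟩,
    exists_lt_treeCutWidth_completeBipartiteGraph, ?_⟩
  · intro n hn
    obtain ⟨hpos, hle⟩ := treeCutWidth_completeBipartiteGraph_three (n - 3)
    set w := (completeBipartiteGraph (Fin 3) (Fin (n - 3))).treeCutWidth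
    -- As `w ≥ 1`, `n ≤ w + w² + 3 ≤ 5w⁴`; the constant 5 is generous.
    have hn' : n ≤ (5 * w) ^ 4 := by
      have h1 : w ≤ w ^ 4 := Nat.le_self_pow (by norm_num) w
      have h2 : w * w ≤ w ^ 4 := by
        rw [← pow_two]; exact Nat.pow_le_pow_right hpos (by norm_num)
      rw [mul_pow]
      omega
    have hroot : (n : ℝ) ^ (1 / 4 : ℝ) ≤ 5 * w := by
      calc (n : ℝ) ^ (1 / 4 : ℝ) ≤ (((5 * w : ℝ)) ^ 4) ^ (1 / 4 : ℝ) :=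
            Real.rpow_le_rpow (by positivity) (by exact_mod_cast hn') (by norm_num)
        _ = 5 * w := by
            have := Real.pow_rpow_inv_natCast (x := 5 * (w : ℝ)) (by positivity)
              (n := 4) (by norm_num)
            rw [one_div]; exact_mod_cast this
    linarith
  · rintro ⟨f, hf⟩
    -- Since `f` need not be monotone, take its maximum over the possible widths 0 to 3.
    obtain ⟨n, -, hn⟩ :=
      exists_lt_treeCutWidth_completeBipartiteGraph ((Finset.range 4).sup f)
    refine (hn.trans_le (hf _ _)).not_ge (Finset.le_sup (f := f) (Finset.mem_range.2 ?_))
    exact Nat.lt_succ_of_le (treePartitionWidth_completeBipartiteGraph_three_le _)
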